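/- Let $\mu,F\in C_c^\infty(\mathbb C)$ be complex-valued with $|\mu|\le k$ everywhere, where $k<1$ is a constant. Let $g\in L^1_{\mathrm{loc}}(\mathbb C)$ be complex-valued, with weak first-order partial derivatives in $L^2(\mathbb C)$, and suppose that $$\partial_{\bar z}g-\mu\,\partial_z g=F$$ in the sense of distributions, that is, for every $\varphi\in C_c^\infty(\mathbb C)$, $$-\int_{\mathbb C} g\,\bigl(\partial_{\bar z}\varphi-\partial_z(\mu\varphi)\bigr)\,dA=\int_{\mathbb C}F\varphi\,dA .$$ Then there is a function $h:\mathbb C\to\mathbb C$ with $g=h$ almost everywhere which is Hölder continuous with exponent $2/3$ (in particular continuous): there is a constant $C$ with $$|h(w_1)-h(w_2)|\le C\,|w_1-w_2|^{2/3}\qquad\text{for all } w_1,w_2\in\mathbb C .$$ The constant $C$ depends only on $\mu$, $F$ and the $L^6$-norm of $g$ on the support of $\mu$. -/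

import Mathlib

open MeasureTheory
open scoped NNReal ENNReal ContDiff

namespace Beltrami

/-- A test function on `ℂ`: complex valued, smooth in the real sense, with compact support. -/
def IsTestFunction (φ : ℂ → ℂ) : Prop :=
  ContDiff ℝ ∞ φ ∧ HasCompactSupport φ

/-- The operator `∂_z = (∂_x - i ∂_y) / 2` on (real) differentiable functions. -/
noncomputable def dz (f : ℂ → ℂ) (z : ℂ) : ℂ :=
  (fderiv ℝ f z 1 - Complex.I * fderiv ℝ f z Complex.I) / 2

/-- The operator `∂_{z̄} = (∂_x + i ∂_y) / 2` on (real) differentiable functions. -/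
noncomputable def dzbar (f : ℂ → ℂ) (z : ℂ) : ℂ :=
  (fderiv ℝ f z 1 + Complex.I * fderiv ℝ f z Complex.I) / 2

/-- `g'` is the weak (distributional) derivative of `g` in the direction `v`; here `g` and `g'` are
locally integrable functions on `ℂ`, up to equality almost everywhere. -/
def IsWeakDeriv (v : ℂ) (g g' : ℂ → ℂ) : Prop :=
  LocallyIntegrable g volume ∧ LocallyIntegrable g' volume ∧
    ∀ φ : ℂ → ℂ, IsTestFunction φ → ∫ z, g z * fderiv ℝ φ z v = -∫ z, g' z * φ z

/-- `Dg ∈ L²(ℂ)`: both first order weak partial derivatives of `g` exist and lie in `L²(ℂ)`. -/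
def HasL2Gradient (g : ℂ → ℂ) : Prop :=
  ∃ gx gy : ℂ → ℂ, IsWeakDeriv 1 g gx ∧ IsWeakDeriv Complex.I g gy ∧
    MemLp gx 2 volume ∧ MemLp gy 2 volume

/-- `∂_{z̄} g - μ ∂_z g = F` in the sense of distributions, for a locally integrable `g`, a smooth
`μ` and a locally integrable `F`. The pairing of the left side with a test function `φ` is
`-∫ g (∂_{z̄} φ - ∂_z (μ φ))`. -/
def SolvesInDistribution (μ F g : ℂ → ℂ) : Prop :=
  ∀ φ : ℂ → ℂ, IsTestFunction φ →
    -∫ z, g z * (dzbar φ z - dz (fun w => μ w * φ w) z) = ∫ z, F z * φ z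

end Beltrami

/-!
The argument works in `L²` and on the Fourier side only. Write `a`, `b` for the weak partial
derivatives of `g`, and `P = (a + i b) / 2`, `Q = (a - i b) / 2` for `∂_{z̄} g`, `∂_z g`.

*Energy estimate.* The field `(a, b)` is curl-free, so its Fourier transform is parallel to the
frequency (`IsCurlFree.fourier`), and Plancherel gives `‖P‖ = ‖Q‖` (`IsCurlFree.eLpNorm_eq`). As
`P - μ Q = F` and `|μ| ≤ k < 1`, it follows that `‖Q‖ ≤ ‖F‖ / (1 - k)`
(`IsCurlFree.energy_estimate`).

*One more derivative.* The differences `g (· + w) - g` solve an equation of the same form, whose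
right-hand side is `O(|w|)` in `L²` because `μ` and `F` are Lipschitz. The energy estimate gives
`‖Q (· + w) - Q‖ = O(|w|)` (`IsCurlFree.translate_estimate`), and letting `w → 0` one obtains
`|ξ| Q̂ ∈ L²` (`lintegral_norm_fourier_le`).

*Hölder continuity.* Formally `ĝ = m := Q̂ / (π i ξ̄)`, and `(1 + |ξ|) Q̂ ∈ L²` makes
`|ξ|^{2/3} m` integrable (`lintegral_symbol_le`). Hence `w ↦ ∫ m(ξ) (exp (2πi ⟨ξ, w⟩) - 1) dξ` is
Hölder continuous of exponent `2/3` (`holderWith_potential`), and it has the same weak gradient as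
`g` (`isWeakDeriv_potential`), so that it differs from `g` by a constant
(`ae_eq_const_of_isWeakDeriv_zero`).

All bounds depend on `μ`, `F` and `k` only. In particular the Hölder constant can be chosen
independently of the `L⁶`-norm of `g`: two solutions with gradient in `L²` differ by a constant.
-/

namespace Beltrami

open scoped SchwartzMap FourierTransform LineDeriv RealInnerProductSpace
open Filter Topology

/-! ### The Fourier transform on `L²(ℂ)` -/

/-- Functions in `L²(ℂ)`, up to equality almost everywhere. -/
noncomputable abbrev L2 := Lp ℂ 2 (volume : Measure ℂ)

theorem integral_mul_fourier (f : L2) (ψ : 𝓢(ℂ, ℂ)) :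
    ∫ x, f x * (𝓕 ψ : 𝓢(ℂ, ℂ)) x = ∫ x, (𝓕 f : L2) x * ψ x := by
  have h := congrArg (fun T : 𝓢'(ℂ, ℂ) => T ψ) (Lp.fourier_toTemperedDistribution_eq f)
  simp only [TemperedDistribution.fourier_apply, Lp.toTemperedDistribution_apply, smul_eq_mul] at h
  simpa only [mul_comm] using h

/-- A real valued smooth compactly supported function, regarded as a complex valued Schwartz
function. -/
noncomputable def schwartzOfReal (φ : ℂ → ℝ) (h1 : ContDiff ℝ ∞ φ) (h2 : HasCompactSupport φ) :
    𝓢(ℂ, ℂ) :=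
  HasCompactSupport.toSchwartzMap (f := fun x => (φ x : ℂ))
    (h2.comp_left (g := Complex.ofReal) rfl) (Complex.ofRealCLM.contDiff.comp h1)

@[simp] theorem schwartzOfReal_apply (φ : ℂ → ℝ) (h1 : ContDiff ℝ ∞ φ)
    (h2 : HasCompactSupport φ) (x : ℂ) : schwartzOfReal φ h1 h2 x = φ x := rfl

theorem ae_eq_of_integral_schwartz_mul_eq {f g : ℂ → ℂ} (hf : LocallyIntegrable f volume)
    (hg : LocallyIntegrable g volume)
    (h : ∀ ψ : 𝓢(ℂ, ℂ), HasCompactSupport ψ → ∫ x, f x * ψ x = ∫ x, g x * ψ x) : f =ᵐ[volume] g := by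
  refine ae_eq_of_integral_contDiff_smul_eq hf hg fun φ h1 h2 => ?_
  have := h (schwartzOfReal φ h1 h2) (h2.comp_left (g := Complex.ofReal) rfl)
  simpa only [schwartzOfReal_apply, Complex.real_smul, mul_comm] using this

/-- The character `w ↦ exp (2πi ⟨ξ, w⟩)` of the additive group `ℂ`. -/
noncomputable def chr (ξ w : ℂ) : ℂ := Real.fourierChar ⟪ξ, w⟫

theorem chr_eq (ξ w : ℂ) : chr ξ w = Complex.exp (Complex.I * (2 * Real.pi * ⟪ξ, w⟫ : ℝ)) := by
  rw [chr, Real.fourierChar_apply]; congr 1; push_cast; ring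

@[simp] theorem norm_chr (ξ w : ℂ) : ‖chr ξ w‖ = 1 := Circle.norm_coe _

@[simp] theorem chr_zero_right (ξ : ℂ) : chr ξ 0 = 1 := by simp [chr]

theorem chr_add_right (ξ w w' : ℂ) : chr ξ (w + w') = chr ξ w * chr ξ w' := by
  simp [chr, inner_add_right, AddChar.map_add_eq_mul]

theorem contDiff_chr_left (w : ℂ) : ContDiff ℝ ∞ fun ξ => chr ξ w := by
  simp only [chr_eq]
  apply ContDiff.cexp
  refine contDiff_const.mul (Complex.ofRealCLM.contDiff.comp ?_)
  exact contDiff_const.mul (contDiff_id.inner ℝ contDiff_const)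

theorem continuous_chr : Continuous fun p : ℂ × ℂ => chr p.1 p.2 := by
  simp only [chr_eq]
  fun_prop

theorem fourier_eq_integral_chr (ψ : 𝓢(ℂ, ℂ)) (x : ℂ) :
    (𝓕 ψ : 𝓢(ℂ, ℂ)) x = ∫ v, chr v (-x) * ψ v := by
  rw [SchwartzMap.fourier_coe, Real.fourier_eq]
  simp [chr, Circle.smul_def]

theorem fourierInv_eq_integral_chr (ψ : 𝓢(ℂ, ℂ)) (x : ℂ) :
    (𝓕⁻ ψ : 𝓢(ℂ, ℂ)) x = ∫ v, chr x v * ψ v := by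
  rw [SchwartzMap.fourierInv_coe, Real.fourierInv_eq]
  simp [chr, Circle.smul_def, real_inner_comm]

/-- Translation becomes multiplication by a character on the Fourier side. -/
theorem fourier_translate {f f' : L2} {w : ℂ} (h : ∀ᵐ x, f' x = f (x + w)) :
    ∀ᵐ ξ, (𝓕 f' : L2) ξ = chr ξ w * (𝓕 f : L2) ξ := by
  have hloc : LocallyIntegrable (𝓕 f : L2) volume :=
    (Lp.memLp (𝓕 f : L2)).locallyIntegrable (by norm_num)
  refine ae_eq_of_integral_schwartz_mul_eq
    ((Lp.memLp (𝓕 f' : L2)).locallyIntegrable (by norm_num)) ?_ fun ψ hψ => ?_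
  · have hm : MemLp (fun ξ => chr ξ w * (𝓕 f : L2) ξ) 2 volume := by
      refine (Lp.memLp (𝓕 f : L2)).of_le ?_ (Eventually.of_forall fun ξ => by simp)
      exact (contDiff_chr_left w).continuous.aestronglyMeasurable.mul
        (Lp.memLp (𝓕 f : L2)).1
    exact hm.locallyIntegrable (by norm_num)
  let ψ' : 𝓢(ℂ, ℂ) := HasCompactSupport.toSchwartzMap (f := fun ξ => chr ξ w * ψ ξ)
    hψ.mul_left ((contDiff_chr_left w).mul (ψ.smooth ⊤))
  have hψ' : ∀ ξ, ψ' ξ = chr ξ w * ψ ξ := fun _ => rfl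
  have key : ∀ x, (𝓕 ψ' : 𝓢(ℂ, ℂ)) (x + w) = (𝓕 ψ : 𝓢(ℂ, ℂ)) x := fun x => by
    rw [fourier_eq_integral_chr, fourier_eq_integral_chr]
    congr 1 with v
    rw [hψ', ← mul_assoc, ← chr_add_right]
    congr 2; ring
  rw [← integral_mul_fourier]
  calc ∫ x, f' x * (𝓕 ψ : 𝓢(ℂ, ℂ)) x = ∫ x, f (x + w) * (𝓕 ψ' : 𝓢(ℂ, ℂ)) (x + w) := by
        refine integral_congr_ae ?_
        filter_upwards [h] with x hx
        rw [hx, key]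
    _ = ∫ x, f x * (𝓕 ψ' : 𝓢(ℂ, ℂ)) x :=
        integral_add_right_eq_self (fun x => f x * (𝓕 ψ' : 𝓢(ℂ, ℂ)) x) w
    _ = ∫ x, chr x w * (𝓕 f : L2) x * ψ x := by
        rw [integral_mul_fourier]
        congr 1 with x
        rw [hψ']; ring

/-! ### Curl-free fields -/

/-- The field `(a, b)` is curl-free in the sense of distributions: `∂_y a = ∂_x b`. -/
def IsCurlFree (a b : ℂ → ℂ) : Prop :=
  ∀ φ : ℂ → ℂ, IsTestFunction φ →
    ∫ z, a z * fderiv ℝ φ z Complex.I = ∫ z, b z * fderiv ℝ φ z 1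

theorem IsTestFunction.fderiv_apply {φ : ℂ → ℂ} (h : IsTestFunction φ) (v : ℂ) :
    IsTestFunction fun z => fderiv ℝ φ z v :=
  ⟨(h.1.fderiv_right (m := ∞) (by simp)).clm_apply contDiff_const, h.2.fderiv_apply ℝ v⟩

/-- A weak gradient is curl-free, because second derivatives of test functions commute. -/
theorem IsWeakDeriv.isCurlFree {g gx gy : ℂ → ℂ} (hx : IsWeakDeriv 1 g gx)
    (hy : IsWeakDeriv Complex.I g gy) : IsCurlFree gx gy := by
  intro φ hφ
  have h1 := hx.2.2 _ (hφ.fderiv_apply Complex.I)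
  have h2 := hy.2.2 _ (hφ.fderiv_apply 1)
  have hd : Differentiable ℝ (fderiv ℝ φ) :=
    (hφ.1.fderiv_right (m := ∞) (by simp)).differentiable (by simp)
  have key : ∀ z, fderiv ℝ (fun z => fderiv ℝ φ z Complex.I) z 1
      = fderiv ℝ (fun z => fderiv ℝ φ z 1) z Complex.I := fun z => by
    have hs : IsSymmSndFDerivAt ℝ φ z :=
      (hφ.1.contDiffAt).isSymmSndFDerivAt (by simpa using ENat.LEInfty.out)
    rw [fderiv_clm_apply (hd z) (by fun_prop), fderiv_clm_apply (hd z) (by fun_prop)]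
    simpa using hs 1 Complex.I
  simp only [key] at h1
  rw [h1] at h2
  simpa using h2

theorem integrable_mul_schwartz {a : ℂ → ℂ} (ha : MemLp a 2 volume) (ψ : 𝓢(ℂ, ℂ)) :
    Integrable fun z => a z * ψ z :=
  ha.integrable_mul (ψ.memLp 2)

/-- For a curl-free field in `L²`, Schwartz functions are admissible test functions: they are cut
off at radius `n → ∞`. -/
theorem IsCurlFree.integral_schwartz {a b : ℂ → ℂ} (h : IsCurlFree a b) (ha : MemLp a 2 volume)
    (hb : MemLp b 2 volume) (ψ : 𝓢(ℂ, ℂ)) :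
    ∫ z, a z * (∂_{Complex.I} ψ : 𝓢(ℂ, ℂ)) z = ∫ z, b z * (∂_{(1 : ℂ)} ψ : 𝓢(ℂ, ℂ)) z := by
  let χ : ContDiffBump (0 : ℂ) := ⟨1, 2, by norm_num, by norm_num⟩
  let χn : ℕ → ℂ → ℂ := fun n z => (χ ((n + 1 : ℝ)⁻¹ • z) : ℝ)
  have hχn : ∀ n, IsTestFunction (χn n) := fun n => by
    constructor
    · exact Complex.ofRealCLM.contDiff.comp (χ.contDiff.comp (contDiff_const_smul _))
    · exact (χ.hasCompactSupport.comp_smul (by positivity)).comp_left (g := Complex.ofReal) rfl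
  obtain ⟨K, hK⟩ : ∃ K, ∀ z, ‖fderiv ℝ (fun z => (χ z : ℂ)) z‖ ≤ K := by
    have hc : ContDiff ℝ ∞ fun z => (χ z : ℂ) := Complex.ofRealCLM.contDiff.comp χ.contDiff
    have hs : HasCompactSupport fun z => (χ z : ℂ) :=
      χ.hasCompactSupport.comp_left (g := Complex.ofReal) rfl
    exact (hs.fderiv ℝ).exists_bound_of_continuous (hc.continuous_fderiv (by simp))
  have hle : ∀ n z, ‖χn n z‖ ≤ 1 := fun n z => by
    simp only [χn, Complex.norm_real, Real.norm_eq_abs, abs_of_nonneg χ.nonneg]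
    exact χ.le_one
  have hdle : ∀ n z, ‖fderiv ℝ (χn n) z‖ ≤ K := fun n z => by
    have : fderiv ℝ (χn n) z
        = (n + 1 : ℝ)⁻¹ • fderiv ℝ (fun z => (χ z : ℂ)) ((n + 1 : ℝ)⁻¹ • z) :=
      fderiv_comp_smul (𝕜 := ℝ) (f := fun z => (χ z : ℂ)) (n + 1 : ℝ)⁻¹
    rw [this, norm_smul, Real.norm_of_nonneg (by positivity)]
    have h1 : (n + 1 : ℝ)⁻¹ ≤ 1 := inv_le_one_of_one_le₀ (by linarith [n.cast_nonneg (α := ℝ)])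
    calc _ ≤ 1 * K := mul_le_mul h1 (hK _) (norm_nonneg _) zero_le_one
      _ = K := one_mul K
  have hev : ∀ z, ∀ᶠ n in atTop, χn n =ᶠ[𝓝 z] fun _ => 1 := fun z => by
    obtain ⟨N, hN⟩ := exists_nat_gt ‖z‖
    filter_upwards [eventually_ge_atTop N] with n hn
    have ho : Metric.ball (0 : ℂ) (n + 1) ∈ 𝓝 z := by
      refine Metric.isOpen_ball.mem_nhds ?_
      have : (N : ℝ) ≤ n := by exact_mod_cast hn
      simp only [Metric.mem_ball, dist_zero_right]; linarith
    filter_upwards [ho] with y hy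
    have : (χ ((n + 1 : ℝ)⁻¹ • y) : ℝ) = 1 := by
      refine χ.one_of_mem_closedBall ?_
      simp only [Metric.mem_ball, dist_zero_right] at hy
      rw [mem_closedBall_zero_iff, norm_smul, Real.norm_of_nonneg (by positivity),
        inv_mul_le_iff₀ (by positivity)]
      simpa [χ] using hy.le
    change ((χ ((n + 1 : ℝ)⁻¹ • y) : ℝ) : ℂ) = 1
    rw [this, Complex.ofReal_one]
  -- Near a given point the cutoffs are eventually `1`, and their gradients are uniformly bounded, so
  -- dominated convergence applies.
  have main : ∀ (c : ℂ → ℂ) (v : ℂ), MemLp c 2 volume →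
      Tendsto (fun n => ∫ z, c z * fderiv ℝ (fun z => χn n z * ψ z) z v) atTop
        (𝓝 (∫ z, c z * (∂_{v} ψ : 𝓢(ℂ, ℂ)) z)) := by
    intro c v hc
    have hder : ∀ n z, fderiv ℝ (fun z => χn n z * ψ z) z v
        = χn n z * (∂_{v} ψ : 𝓢(ℂ, ℂ)) z + ψ z * fderiv ℝ (χn n) z v := fun n z => by
      rw [SchwartzMap.lineDerivOp_apply_eq_fderiv,
        fderiv_fun_mul ((hχn n).1.differentiable (by simp) z) ψ.differentiableAt]
      simp
    refine tendsto_integral_of_dominated_convergence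
      (fun z => ‖c z * (∂_{v} ψ : 𝓢(ℂ, ℂ)) z‖ + (K * ‖v‖) * ‖c z * ψ z‖) (fun n => ?_) ?_
      (fun n => Eventually.of_forall fun z => ?_) (Eventually.of_forall fun z => ?_)
    · refine hc.1.mul (Continuous.aestronglyMeasurable ?_)
      have : ContDiff ℝ ∞ fun z => χn n z * ψ z := (hχn n).1.mul (ψ.smooth ⊤)
      exact (this.continuous_fderiv (by simp)).clm_apply continuous_const
    · exact (integrable_mul_schwartz hc _).norm.add
        ((integrable_mul_schwartz hc ψ).norm.const_mul _)
    · rw [hder, mul_add]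
      refine (norm_add_le _ _).trans (add_le_add ?_ ?_)
      · rw [mul_left_comm, norm_mul]
        exact mul_le_of_le_one_left (norm_nonneg _) (hle n z)
      · rw [← mul_assoc, norm_mul, mul_comm]
        refine mul_le_mul_of_nonneg_right ?_ (norm_nonneg _)
        exact ((fderiv ℝ (χn n) z).le_opNorm v).trans
          (mul_le_mul_of_nonneg_right (hdle n z) (norm_nonneg _))
    · refine tendsto_const_nhds.congr' ?_
      filter_upwards [hev z] with n hn
      rw [hder, hn.fderiv_eq, hn.eq_of_nhds]
      simp
  refine tendsto_nhds_unique (main a Complex.I ha) ?_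
  refine (main b 1 hb).congr fun n => (h _ ⟨(hχn n).1.mul (ψ.smooth ⊤), ?_⟩).symm
  exact (hχn n).2.mul_right

theorem hasTemperateGrowth_inner (v : ℂ) :
    Function.HasTemperateGrowth fun ξ : ℂ => (⟪ξ, v⟫ : ℝ) := by fun_prop

theorem lineDeriv_fourier_eq (v : ℂ) (ψ : 𝓢(ℂ, ℂ)) : (∂_{v} (𝓕 ψ) : 𝓢(ℂ, ℂ)) =
    𝓕 (-(2 * Real.pi * Complex.I) • SchwartzMap.smulLeftCLM ℂ (fun ξ : ℂ => (⟪ξ, v⟫ : ℝ)) ψ) :=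
  SchwartzMap.lineDerivOp_fourier_eq ψ v

theorem integral_mul_lineDeriv_fourier (f : L2) (v : ℂ) (ψ : 𝓢(ℂ, ℂ)) :
    ∫ x, f x * (∂_{v} (𝓕 ψ) : 𝓢(ℂ, ℂ)) x
      = -(2 * Real.pi * Complex.I) * ∫ ξ, (⟪ξ, v⟫ : ℝ) * (𝓕 f : L2) ξ * ψ ξ := by
  rw [lineDeriv_fourier_eq, integral_mul_fourier, ← integral_const_mul]
  congr 1 with ξ
  simp only [smul_apply, smul_eq_mul,
    SchwartzMap.smulLeftCLM_apply_apply (hasTemperateGrowth_inner v), Complex.real_smul]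
  ring

/-- On the Fourier side, a curl-free field is everywhere parallel to the frequency. -/
theorem IsCurlFree.fourier {f₁ f₂ : L2} (h : IsCurlFree f₁ f₂) :
    ∀ᵐ ξ : ℂ, (ξ.im : ℂ) * (𝓕 f₁ : L2) ξ = ξ.re * (𝓕 f₂ : L2) ξ := by
  have hl : ∀ f : L2, LocallyIntegrable (f : ℂ → ℂ) volume := fun f =>
    (Lp.memLp f).locallyIntegrable (by norm_num)
  refine ae_eq_of_integral_schwartz_mul_eq
    ((hl _).continuous_mul (Complex.continuous_ofReal.comp Complex.continuous_im))
    ((hl _).continuous_mul (Complex.continuous_ofReal.comp Complex.continuous_re)) fun ψ _ => ?_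
  have := h.integral_schwartz (Lp.memLp f₁) (Lp.memLp f₂) (𝓕 ψ)
  rw [integral_mul_lineDeriv_fourier, integral_mul_lineDeriv_fourier] at this
  have := mul_left_cancel₀ (by simp [Real.pi_ne_zero]) this
  simpa using this

theorem norm_add_I_mul_eq {ξ a b : ℂ} (hξ : ξ ≠ 0) (h : (ξ.im : ℂ) * a = ξ.re * b) :
    ‖a + Complex.I * b‖ = ‖a - Complex.I * b‖ := by
  by_cases h0 : ξ.re = 0
  · have him : ξ.im ≠ 0 := fun h1 => hξ (Complex.ext h0 h1)
    have ha : a = 0 := by simpa [h0, him] using h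
    simp [ha]
  · have hb : b = ((ξ.im / ξ.re : ℝ) : ℂ) * a := by
      have : (ξ.re : ℂ) ≠ 0 := by exact_mod_cast h0
      push_cast; field_simp; rw [h, mul_comm]
    generalize ξ.im / ξ.re = t at hb
    have h1 : a + Complex.I * b = (1 + Complex.I * t) * a := by rw [hb]; ring
    have h2 : a - Complex.I * b = (starRingEnd ℂ) (1 + Complex.I * t) * a := by
      rw [hb]; simp; ring
    rw [h1, h2, norm_mul, norm_mul, Complex.norm_conj]

theorem fourier_combination (f₁ f₂ : L2) (c : ℂ) :
    ∀ᵐ ξ, (𝓕 (f₁ + c • f₂) : L2) ξ = (𝓕 f₁ : L2) ξ + c * (𝓕 f₂ : L2) ξ := by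
  rw [FourierTransform.fourier_add, FourierTransform.fourier_smul]
  filter_upwards [Lp.coeFn_add (𝓕 f₁ : L2) (c • 𝓕 f₂ : L2), Lp.coeFn_smul c (𝓕 f₂ : L2)]
    with ξ h1 h2
  rw [h1, Pi.add_apply, h2, Pi.smul_apply, smul_eq_mul]

theorem IsCurlFree.norm_eq {f₁ f₂ : L2} (h : IsCurlFree f₁ f₂) :
    ‖f₁ + Complex.I • f₂‖ = ‖f₁ + (-Complex.I) • f₂‖ := by
  rw [← Lp.norm_fourier_eq (f₁ + Complex.I • f₂), ← Lp.norm_fourier_eq (f₁ + (-Complex.I) • f₂),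
    Lp.norm_def, Lp.norm_def]
  congr 1
  refine eLpNorm_congr_norm_ae ?_
  filter_upwards [h.fourier, fourier_combination f₁ f₂ Complex.I,
    fourier_combination f₁ f₂ (-Complex.I), Measure.ae_ne volume (0 : ℂ)] with ξ h1 h2 h3 h0
  rw [h2, h3, norm_add_I_mul_eq h0 h1, neg_mul, sub_eq_add_neg]

theorem IsCurlFree.congr {a b a' b' : ℂ → ℂ} (h : IsCurlFree a b) (ha : a =ᵐ[volume] a')
    (hb : b =ᵐ[volume] b') : IsCurlFree a' b' := by
  intro φ hφ
  have h1 : ∫ z, a' z * fderiv ℝ φ z Complex.I = ∫ z, a z * fderiv ℝ φ z Complex.I :=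
    integral_congr_ae (by filter_upwards [ha] with z hz; rw [hz])
  have h2 : ∫ z, b' z * fderiv ℝ φ z 1 = ∫ z, b z * fderiv ℝ φ z 1 :=
    integral_congr_ae (by filter_upwards [hb] with z hz; rw [hz])
  rw [h1, h2, h φ hφ]

/-- The Beurling transform is an isometry of `L²`: for a curl-free field `(a, b)`, that is the
gradient of some `g`, the functions `2 ∂_{z̄} g = a + i b` and `2 ∂_z g = a - i b` have the same
norm. -/
theorem IsCurlFree.eLpNorm_eq {a b : ℂ → ℂ} (h : IsCurlFree a b) (ha : MemLp a 2 volume)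
    (hb : MemLp b 2 volume) :
    eLpNorm (fun z => (a z + Complex.I * b z) / 2) 2 volume
      = eLpNorm (fun z => (a z - Complex.I * b z) / 2) 2 volume := by
  have h' : IsCurlFree (ha.toLp : L2) (hb.toLp : L2) :=
    h.congr ha.coeFn_toLp.symm hb.coeFn_toLp.symm
  have e : ∀ c : ℂ, eLpNorm (fun z => (a z + c * b z) / 2) 2 volume
      = ‖(2⁻¹ : ℂ)‖ₑ * ‖(ha.toLp : L2) + c • hb.toLp‖ₑ := fun c => by
    have h1 : (fun z => (a z + c * b z) / 2) = (2⁻¹ : ℂ) • (a + c • b) := by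
      ext z; simp; ring
    rw [h1, eLpNorm_const_smul, ← MemLp.toLp_const_smul, ← MemLp.toLp_add, Lp.enorm_toLp]
  have := e (-Complex.I)
  simp only [neg_mul, ← sub_eq_add_neg] at this
  rw [e, this, enorm_eq_iff_norm_eq.2 h'.norm_eq]

/-- The energy estimate for `∂_{z̄} g - μ ∂_z g = R`, with `(a, b)` the gradient of `g`: since
`∂_{z̄} g` and `∂_z g` have the same norm and `|μ| ≤ k < 1`, the term `μ ∂_z g` is absorbed. -/
theorem IsCurlFree.energy_estimate {a b μ R : ℂ → ℂ} {k : ℝ} (hk : k < 1) (hμk : ∀ z, ‖μ z‖ ≤ k)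
    (hμ : Continuous μ) (h : IsCurlFree a b) (ha : MemLp a 2 volume) (hb : MemLp b 2 volume)
    (hR : ∀ᵐ z, (a z + Complex.I * b z) / 2 - μ z * ((a z - Complex.I * b z) / 2) = R z) :
    eLpNorm (fun z => (a z - Complex.I * b z) / 2) 2 volume
      ≤ ENNReal.ofReal (1 - k)⁻¹ * eLpNorm R 2 volume := by
  have hQ : MemLp (fun z => (a z - Complex.I * b z) / 2) 2 volume := by
    simp only [div_eq_inv_mul]
    exact (ha.sub (hb.const_mul Complex.I)).const_mul 2⁻¹
  have hP : MemLp (fun z => (a z + Complex.I * b z) / 2) 2 volume := by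
    simp only [div_eq_inv_mul]
    exact (ha.add (hb.const_mul Complex.I)).const_mul 2⁻¹
  have hPQ := h.eLpNorm_eq ha hb
  set Q := fun z => (a z - Complex.I * b z) / 2
  set P := fun z => (a z + Complex.I * b z) / 2
  have hk0 : 0 ≤ k := (norm_nonneg _).trans (hμk 0)
  have hμQ : AEStronglyMeasurable (fun z => μ z * Q z) volume :=
    hμ.aestronglyMeasurable.mul hQ.1
  have hRm : AEStronglyMeasurable R volume := (hP.1.sub hμQ).congr hR
  have h1 : eLpNorm P 2 volume ≤ eLpNorm R 2 volume + ENNReal.ofReal k * eLpNorm Q 2 volume := by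
    calc eLpNorm P 2 volume = eLpNorm (R + fun z => μ z * Q z) 2 volume := by
          refine eLpNorm_congr_ae ?_
          filter_upwards [hR] with z hz
          simp only [Pi.add_apply, ← hz, P, Q]; ring
      _ ≤ eLpNorm R 2 volume + eLpNorm (fun z => μ z * Q z) 2 volume :=
          eLpNorm_add_le hRm hμQ (by norm_num)
      _ ≤ _ := by
          gcongr
          refine eLpNorm_le_mul_eLpNorm_of_ae_le_mul (Eventually.of_forall fun z => ?_) 2
          rw [norm_mul]
          exact mul_le_mul_of_nonneg_right (hμk z) (norm_nonneg _)
  rw [hPQ] at h1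
  rw [ENNReal.ofReal_inv_of_pos (by linarith), mul_comm, ← div_eq_mul_inv,
    ENNReal.le_div_iff_mul_le (.inl (by simpa using hk)) (.inl ENNReal.ofReal_ne_top),
    ENNReal.ofReal_sub _ hk0, ENNReal.ofReal_one, ENNReal.mul_sub (fun _ _ => hQ.2.ne), mul_one,
    tsub_le_iff_right, mul_comm]
  exact h1

/-! ### Difference quotients -/

theorem memLp_comp_add_right {f : ℂ → ℂ} (hf : MemLp f 2 volume) (w : ℂ) :
    MemLp (fun z => f (z + w)) 2 volume :=
  hf.comp_measurePreserving (measurePreserving_add_right volume w)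

theorem eLpNorm_comp_add_right {f : ℂ → ℂ} (hf : AEStronglyMeasurable f volume) (w : ℂ) :
    eLpNorm (fun z => f (z + w)) 2 volume = eLpNorm f 2 volume :=
  eLpNorm_comp_measurePreserving hf (measurePreserving_add_right volume w)

theorem IsCurlFree.translate_sub {a b : ℂ → ℂ} (h : IsCurlFree a b) (ha : MemLp a 2 volume)
    (hb : MemLp b 2 volume) (w : ℂ) :
    IsCurlFree (fun z => a (z + w) - a z) (fun z => b (z + w) - b z) := by
  intro φ hφ
  have hφ' : IsTestFunction fun z => φ (z - w) :=
    ⟨hφ.1.comp (contDiff_id.sub contDiff_const),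
      hφ.2.comp_homeomorph (Homeomorph.subRight w)⟩
  have hd : ∀ z v, fderiv ℝ (fun z => φ (z - w)) z v = fderiv ℝ φ (z - w) v := fun z v => by
    simp only [sub_eq_add_neg, fderiv_comp_add_right]
  have key : ∀ (c : ℂ → ℂ) (v : ℂ), MemLp c 2 volume →
      ∫ z, (c (z + w) - c z) * fderiv ℝ φ z v
        = (∫ z, c z * fderiv ℝ (fun z => φ (z - w)) z v) - ∫ z, c z * fderiv ℝ φ z v := by
    intro c v hc
    have hT := hφ.fderiv_apply v
    have hi : ∀ c : ℂ → ℂ, MemLp c 2 volume → Integrable fun z => c z * fderiv ℝ φ z v :=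
      fun c hc => integrable_mul_schwartz hc (hT.2.toSchwartzMap hT.1)
    simp only [sub_mul, hd]
    rw [integral_sub (hi _ (memLp_comp_add_right hc w)) (hi c hc),
      ← integral_add_right_eq_self (fun z => c z * fderiv ℝ φ (z - w) v) w]
    simp
  rw [key a _ ha, key b _ hb, h _ hφ, h _ hφ']

/-- Translating the equation and subtracting gives an equation of the same type for the
differences, so the energy estimate makes `∂_z g` Lipschitz under translation in `L²`. -/
theorem IsCurlFree.translate_estimate {a b μ F : ℂ → ℂ} {k : ℝ} {L : ℝ≥0} {N : ℝ≥0∞} (hk : k < 1)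
    (hμk : ∀ z, ‖μ z‖ ≤ k) (hμ : LipschitzWith L μ) (hFm : AEStronglyMeasurable F volume)
    (hF : ∀ w, eLpNorm (fun z => F (z + w) - F z) 2 volume ≤ N * ‖w‖ₑ)
    (h : IsCurlFree a b) (ha : MemLp a 2 volume) (hb : MemLp b 2 volume)
    (hE : ∀ᵐ z, (a z + Complex.I * b z) / 2 - μ z * ((a z - Complex.I * b z) / 2) = F z)
    {Q : ℂ → ℂ} (hQ : Q = fun z => (a z - Complex.I * b z) / 2) (w : ℂ) :
    eLpNorm (fun z => Q (z + w) - Q z) 2 volume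
      ≤ ENNReal.ofReal (1 - k)⁻¹ * (N + L * eLpNorm Q 2 volume) * ‖w‖ₑ := by
  have hQm : AEStronglyMeasurable Q volume := by
    rw [hQ]
    simp only [div_eq_inv_mul]
    exact ((ha.sub (hb.const_mul Complex.I)).const_mul 2⁻¹).1
  have hmp := measurePreserving_add_right (volume : Measure ℂ) w
  let R : ℂ → ℂ := fun z => (F (z + w) - F z) + (μ (z + w) - μ z) * Q (z + w)
  have hR : ∀ᵐ z, ((a (z + w) - a z) + Complex.I * (b (z + w) - b z)) / 2
      - μ z * (((a (z + w) - a z) - Complex.I * (b (z + w) - b z)) / 2) = R z := by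
    filter_upwards [hE, hmp.quasiMeasurePreserving.ae hE] with z h1 h2
    simp only [R, ← h1, ← h2, hQ]
    ring
  have hle := (h.translate_sub ha hb w).energy_estimate hk hμk hμ.continuous
    ((memLp_comp_add_right ha w).sub ha) ((memLp_comp_add_right hb w).sub hb) hR
  have hRle : eLpNorm R 2 volume ≤ (N + L * eLpNorm Q 2 volume) * ‖w‖ₑ := by
    have hQw : AEStronglyMeasurable (fun z => Q (z + w)) volume :=
      hQm.comp_measurePreserving hmp
    have hFw : AEStronglyMeasurable (fun z => F (z + w)) volume :=
      hFm.comp_measurePreserving hmp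
    have hd : AEStronglyMeasurable (fun z => μ (z + w) - μ z) volume :=
      ((hμ.continuous.comp (continuous_add_const w)).sub hμ.continuous).aestronglyMeasurable
    refine (eLpNorm_add_le (hFw.sub hFm) (hd.mul hQw) (by norm_num)).trans ?_
    rw [add_mul]
    refine add_le_add (hF w) ?_
    rw [mul_right_comm, ← eLpNorm_comp_add_right hQm w]
    refine eLpNorm_le_mul_eLpNorm_of_ae_le_mul'' 2 hQw (Eventually.of_forall fun z => ?_)
    change ‖(μ (z + w) - μ z) * Q (z + w)‖ₑ ≤ _
    rw [enorm_mul]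
    gcongr
    simpa [edist_eq_enorm_sub] using hμ (z + w) z
  have hQd : (fun z => Q (z + w) - Q z)
      = fun z => ((a (z + w) - a z) - Complex.I * (b (z + w) - b z)) / 2 := by
    ext z; rw [hQ]; ring
  rw [hQd, mul_assoc]
  exact hle.trans (by gcongr)

/-- A Lipschitz function with compact support is Lipschitz under translation in `L²`. -/
theorem exists_eLpNorm_translate_sub_le {F : ℂ → ℂ} {L : ℝ≥0} (hF : LipschitzWith L F)
    (hFc : HasCompactSupport F) : ∃ N : ℝ≥0∞, N ≠ ⊤ ∧
      ∀ w, eLpNorm (fun z => F (z + w) - F z) 2 volume ≤ N * ‖w‖ₑ := by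
  let χ : ℂ → ℂ := (tsupport F).indicator fun _ => 1
  have hχ : MemLp χ 2 volume :=
    memLp_indicator_const 2 hFc.isClosed.measurableSet 1 (.inr hFc.measure_lt_top.ne)
  refine ⟨L * (eLpNorm χ 2 volume + eLpNorm χ 2 volume),
    ENNReal.mul_ne_top ENNReal.coe_ne_top (ENNReal.add_ne_top.2 ⟨hχ.2.ne, hχ.2.ne⟩), fun w => ?_⟩
  have hχw := memLp_comp_add_right hχ w
  have hz : ∀ z, ‖F (z + w) - F z‖ₑ ≤ (L * ‖w‖ₑ) * ‖χ (z + w) + χ z‖ₑ := fun z => by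
    by_cases h1 : z ∈ tsupport F ∨ z + w ∈ tsupport F
    · have h2 : (1 : ℝ≥0∞) ≤ ‖χ (z + w) + χ z‖ₑ := by
        by_cases h3 : z ∈ tsupport F <;> by_cases h4 : z + w ∈ tsupport F
        · simp only [χ, h3, h4, Set.indicator_of_mem]; norm_num [← ofReal_norm]
        all_goals simp_all [χ]
      calc ‖F (z + w) - F z‖ₑ ≤ L * ‖w‖ₑ := by simpa [edist_eq_enorm_sub] using hF (z + w) z
        _ ≤ _ := le_mul_of_one_le_right (zero_le) h2
    · push Not at h1
      simp [image_eq_zero_of_notMem_tsupport h1.1, image_eq_zero_of_notMem_tsupport h1.2]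
  calc _ ≤ (L * ‖w‖ₑ) * eLpNorm (fun z => χ (z + w) + χ z) 2 volume :=
        eLpNorm_le_mul_eLpNorm_of_ae_le_mul'' 2 (hχw.1.add hχ.1) (Eventually.of_forall hz)
    _ ≤ (L * ‖w‖ₑ) * (eLpNorm χ 2 volume + eLpNorm χ 2 volume) := by
        gcongr
        refine (eLpNorm_add_le hχw.1 hχ.1 (by norm_num)).trans ?_
        rw [eLpNorm_comp_add_right hχ.1]
    _ = _ := by ring

theorem eLpNorm_fourier (f : L2) :
    eLpNorm (𝓕 f : L2) 2 volume = eLpNorm f 2 volume := by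
  rw [← Lp.enorm_def, ← Lp.enorm_def, enorm_eq_iff_norm_eq, Lp.norm_fourier_eq]

theorem lintegral_enorm_sq (f : ℂ → ℂ) : ∫⁻ z, ‖f z‖ₑ ^ 2 = eLpNorm f 2 volume ^ 2 := by
  have := eLpNorm_nnreal_pow_eq_lintegral (f := f) (μ := volume) (p := 2) two_ne_zero
  simpa using this.symm

theorem tendsto_chr_difference_quotient (ξ v : ℂ) :
    Tendsto (fun n : ℕ => ‖((n : ℝ) + 1) • (chr ξ (((n : ℝ) + 1)⁻¹ • v) - 1)‖ₑ) atTop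
      (𝓝 ‖(2 * Real.pi * ⟪ξ, v⟫ : ℝ) * Complex.I‖ₑ) := by
  have hd : HasDerivAt (fun t : ℝ => chr ξ (t • v))
      ((2 * Real.pi * ⟪ξ, v⟫ : ℝ) * Complex.I) 0 := by
    have h1 : (fun t : ℝ => chr ξ (t • v))
        = fun t : ℝ => Complex.exp (t * ((2 * Real.pi * ⟪ξ, v⟫ : ℝ) * Complex.I)) := by
      ext t
      rw [chr_eq, inner_smul_right]
      congr 1; push_cast; ring
    have h2 := (((hasDerivAt_id (0 : ℝ)).ofReal_comp).mul_const
      ((2 * Real.pi * ⟪ξ, v⟫ : ℝ) * Complex.I)).cexp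
    rw [h1]
    simpa using h2
  have h3 : Tendsto (fun n : ℕ => ((n : ℝ) + 1)⁻¹) atTop (𝓝[≠] 0) := by
    refine tendsto_nhdsWithin_iff.2 ⟨?_, Eventually.of_forall fun n => ?_⟩
    · simpa [one_div] using tendsto_one_div_add_atTop_nhds_zero_nat (𝕜 := ℝ)
    · have : (0 : ℝ) < (n + 1 : ℝ)⁻¹ := by positivity
      exact this.ne'
  have h4 := (hd.tendsto_slope_zero.comp h3).enorm
  simpa [Function.comp_def] using h4

/-- A function that is Lipschitz under translation in `L²` has its weak derivatives in `L²`; here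
in terms of the Fourier transform. -/
theorem lintegral_inner_fourier_le {q : L2} {M : ℝ≥0∞}
    (h : ∀ w, eLpNorm (fun z => q (z + w) - q z) 2 volume ≤ M * ‖w‖ₑ) (v : ℂ) :
    ∫⁻ ξ, (‖(⟪ξ, v⟫ : ℝ)‖ₑ * ‖(𝓕 q : L2) ξ‖ₑ) ^ 2 ≤ (M * ‖v‖ₑ) ^ 2 := by
  have hm : AEMeasurable (fun ξ => ‖(𝓕 q : L2) ξ‖ₑ) volume := (Lp.memLp (𝓕 q : L2)).1.enorm
  have h1 : ∀ w, ∫⁻ ξ, (‖chr ξ w - 1‖ₑ * ‖(𝓕 q : L2) ξ‖ₑ) ^ 2 ≤ (M * ‖w‖ₑ) ^ 2 := fun w => by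
    let qw : L2 := (memLp_comp_add_right (Lp.memLp q) w).toLp
    have hqw : ∀ᵐ x, qw x = q (x + w) := MemLp.coeFn_toLp _
    have e1 : ∫⁻ ξ, (‖chr ξ w - 1‖ₑ * ‖(𝓕 q : L2) ξ‖ₑ) ^ 2
        = ∫⁻ ξ, ‖(𝓕 (qw + (-1 : ℂ) • q) : L2) ξ‖ₑ ^ 2 := by
      refine lintegral_congr_ae ?_
      filter_upwards [fourier_combination qw q (-1), fourier_translate hqw] with ξ h1 h2
      rw [h1, h2, ← enorm_mul]
      congr 2; ring
    have e2 : eLpNorm (qw + (-1 : ℂ) • q : L2) 2 volume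
        = eLpNorm (fun z => q (z + w) - q z) 2 volume := by
      refine eLpNorm_congr_ae ?_
      filter_upwards [Lp.coeFn_add qw ((-1 : ℂ) • q), Lp.coeFn_smul (-1 : ℂ) q, hqw]
        with z h1 h2 h3
      rw [h1, Pi.add_apply, h2, h3]
      simp [sub_eq_add_neg]
    rw [e1, lintegral_enorm_sq, eLpNorm_fourier, e2]
    exact pow_le_pow_left' (h w) 2
  let f : ℕ → ℂ → ℝ≥0∞ := fun n ξ =>
    (‖((n : ℝ) + 1) • (chr ξ (((n : ℝ) + 1)⁻¹ • v) - 1)‖ₑ * ‖(𝓕 q : L2) ξ‖ₑ) ^ 2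
  have hf : ∀ n, ∫⁻ ξ, f n ξ ≤ (M * ‖v‖ₑ) ^ 2 := fun n => by
    have hn : ‖((n : ℝ) + 1)‖ₑ * ‖((n : ℝ) + 1)⁻¹‖ₑ = 1 := by
      rw [← enorm_mul, mul_inv_cancel₀ (by positivity), enorm_one]
    calc ∫⁻ ξ, f n ξ = ∫⁻ ξ, ‖((n : ℝ) + 1)‖ₑ ^ 2 *
            (‖chr ξ (((n : ℝ) + 1)⁻¹ • v) - 1‖ₑ * ‖(𝓕 q : L2) ξ‖ₑ) ^ 2 := by
          congr 1 with ξ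
          simp only [f, enorm_smul]; ring
      _ = ‖((n : ℝ) + 1)‖ₑ ^ 2 *
            ∫⁻ ξ, (‖chr ξ (((n : ℝ) + 1)⁻¹ • v) - 1‖ₑ * ‖(𝓕 q : L2) ξ‖ₑ) ^ 2 :=
          lintegral_const_mul' _ _ (by finiteness)
      _ ≤ ‖((n : ℝ) + 1)‖ₑ ^ 2 * (M * ‖((n : ℝ) + 1)⁻¹ • v‖ₑ) ^ 2 := by
          gcongr; exact h1 _
      _ = (‖((n : ℝ) + 1)‖ₑ * ‖((n : ℝ) + 1)⁻¹‖ₑ) ^ 2 * (M * ‖v‖ₑ) ^ 2 := by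
          rw [enorm_smul]; ring
      _ = _ := by rw [hn]; simp
  -- Fatou's lemma for the difference quotients with step `v / (n + 1)`.
  have hlim : ∀ᵐ ξ, Tendsto (fun n => f n ξ) atTop
      (𝓝 ((‖(2 * Real.pi * ⟪ξ, v⟫ : ℝ) * Complex.I‖ₑ * ‖(𝓕 q : L2) ξ‖ₑ) ^ 2)) :=
    Eventually.of_forall fun ξ => ENNReal.Tendsto.pow
      (ENNReal.Tendsto.mul_const (tendsto_chr_difference_quotient ξ v) (.inr enorm_ne_top))
  have hfm : ∀ n, AEMeasurable (f n) volume := fun n => by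
    have hc : Continuous fun ξ => ((n : ℝ) + 1) • (chr ξ (((n : ℝ) + 1)⁻¹ • v) - 1) := by
      have h0 := (contDiff_chr_left (((n : ℝ) + 1)⁻¹ • v)).continuous
      fun_prop
    exact (hc.enorm.aemeasurable.mul hm).pow_const 2
  calc ∫⁻ ξ, (‖(⟪ξ, v⟫ : ℝ)‖ₑ * ‖(𝓕 q : L2) ξ‖ₑ) ^ 2
      ≤ ∫⁻ ξ, liminf (fun n => f n ξ) atTop := by
        refine lintegral_mono_ae ?_
        filter_upwards [hlim] with ξ hξ
        rw [hξ.liminf_eq]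
        gcongr
        rw [enorm_le_iff_norm_le, norm_mul, Complex.norm_real, Complex.norm_I, mul_one, norm_mul]
        refine le_mul_of_one_le_left (norm_nonneg _) ?_
        rw [Real.norm_of_nonneg (by positivity)]
        linarith [Real.pi_gt_three]
    _ ≤ liminf (fun n => ∫⁻ ξ, f n ξ) atTop := lintegral_liminf_le' hfm
    _ ≤ (M * ‖v‖ₑ) ^ 2 := by
        refine (liminf_le_liminf (Eventually.of_forall hf)).trans ?_
        simp

/-- The estimates in the two coordinate directions, added up. -/
theorem lintegral_norm_fourier_le {q : L2} {M : ℝ≥0∞}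
    (h : ∀ w, eLpNorm (fun z => q (z + w) - q z) 2 volume ≤ M * ‖w‖ₑ) :
    ∫⁻ ξ, (‖ξ‖ₑ * ‖(𝓕 q : L2) ξ‖ₑ) ^ 2 ≤ 2 * M ^ 2 := by
  have hm : AEMeasurable (fun ξ => ‖(𝓕 q : L2) ξ‖ₑ) volume := (Lp.memLp (𝓕 q : L2)).1.enorm
  have hs : ∀ ξ : ℂ, ‖ξ‖ₑ ^ 2 = ‖(⟪ξ, 1⟫ : ℝ)‖ₑ ^ 2 + ‖(⟪ξ, Complex.I⟫ : ℝ)‖ₑ ^ 2 := fun ξ => by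
    have : ‖ξ‖ ^ 2 = ‖ξ.re‖ ^ 2 + ‖ξ.im‖ ^ 2 := by
      rw [← Complex.normSq_eq_norm_sq, Complex.normSq_apply]; simp [sq]
    simp only [← ofReal_norm, ← ENNReal.ofReal_pow (norm_nonneg _)]
    rw [← ENNReal.ofReal_add (by positivity) (by positivity), this]
    simp
  calc _ = ∫⁻ ξ : ℂ, ((‖(⟪ξ, 1⟫ : ℝ)‖ₑ * ‖(𝓕 q : L2) ξ‖ₑ) ^ 2
          + (‖(⟪ξ, Complex.I⟫ : ℝ)‖ₑ * ‖(𝓕 q : L2) ξ‖ₑ) ^ 2) := by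
        congr 1 with ξ
        simp only [mul_pow, hs, add_mul]
    _ = _ := by
        refine lintegral_add_left' (AEMeasurable.pow_const (AEMeasurable.mul ?_ hm) 2) _
        exact (Continuous.enorm (by fun_prop)).aemeasurable
    _ ≤ (M * ‖(1 : ℂ)‖ₑ) ^ 2 + (M * ‖Complex.I‖ₑ) ^ 2 :=
        add_le_add (lintegral_inner_fourier_le h 1) (lintegral_inner_fourier_le h Complex.I)
    _ = 2 * M ^ 2 := by
        have : ‖Complex.I‖ₑ = 1 := by rw [← ofReal_norm]; simp
        rw [this, enorm_one]; ring

/-! ### A weighted integrability estimate -/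

/-- The weight `|ξ|^{-1/3} / (1 + |ξ|)`, which is square integrable on the plane. -/
noncomputable def weight (ξ : ℂ) : ℝ := ‖ξ‖ ^ (-(1 / 3) : ℝ) / (1 + ‖ξ‖)

theorem measurable_weight : Measurable weight := by unfold weight; fun_prop

theorem integrable_weight_sq : Integrable (fun ξ : ℂ => weight ξ ^ 2) volume := by
  -- In polar coordinates the integrand is `y ^ (1/3) (1 + y) ^ (-2) ≤ (1 + y) ^ (-5/3)`.
  refine (integrable_fun_norm_addHaar (volume : Measure ℂ)
    (f := fun y : ℝ => (y ^ (-(1 / 3) : ℝ) / (1 + y)) ^ 2)).2 ?_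
  have h1 : Integrable (fun y : ℝ => (1 + ‖y‖) ^ (-(5 / 3) : ℝ)) volume :=
    integrable_one_add_norm (by simp; norm_num)
  refine h1.integrableOn.mono' (Measurable.aestronglyMeasurable (by fun_prop)) ?_
  filter_upwards [ae_restrict_mem measurableSet_Ioi] with y hy
  have hy0 : (0 : ℝ) < y := hy
  have e1 : y ^ (Module.finrank ℝ ℂ - 1) • (y ^ (-(1 / 3) : ℝ) / (1 + y)) ^ 2
      = y ^ (1 / 3 : ℝ) * (1 + y) ^ (-2 : ℝ) := by
    rw [Complex.finrank_real_complex, smul_eq_mul, div_pow, ← Real.rpow_natCast (y ^ _),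
      ← Real.rpow_mul hy0.le, Real.rpow_neg (by positivity), div_eq_mul_inv, ← mul_assoc]
    congr 1
    · nth_rewrite 1 [← Real.rpow_one y]
      rw [← Real.rpow_natCast (y ^ (1 : ℝ)), ← Real.rpow_mul hy0.le, ← Real.rpow_add hy0]
      norm_num
    · norm_cast
  rw [e1, Real.norm_of_nonneg (by positivity), Real.norm_of_nonneg hy0.le]
  calc y ^ (1 / 3 : ℝ) * (1 + y) ^ (-2 : ℝ) ≤ (1 + y) ^ (1 / 3 : ℝ) * (1 + y) ^ (-2 : ℝ) := by
        gcongr; linarith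
    _ = (1 + y) ^ (-(5 / 3) : ℝ) := by
        rw [← Real.rpow_add (by positivity)]; norm_num

/-- The Fourier transform of `g`, as recovered from the Fourier transform `q` of `∂_z g`. -/
noncomputable def symbol (q : ℂ → ℂ) (ξ : ℂ) : ℂ :=
  q ξ / (Real.pi * Complex.I * (starRingEnd ℂ) ξ)

theorem norm_symbol_mul_le (q : ℂ → ℂ) (ξ : ℂ) :
    ‖symbol q ξ‖ * ‖ξ‖ ^ (2 / 3 : ℝ) ≤ weight ξ * ‖q ξ‖ + weight ξ * (‖ξ‖ * ‖q ξ‖) := by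
  rcases eq_or_ne ξ 0 with rfl | h0
  · simp [symbol, weight]
  have hξ : 0 < ‖ξ‖ := norm_pos_iff.2 h0
  have e1 : weight ξ * ‖q ξ‖ + weight ξ * (‖ξ‖ * ‖q ξ‖) = ‖ξ‖ ^ (-(1 / 3) : ℝ) * ‖q ξ‖ := by
    unfold weight
    field_simp
  have e2 : ‖symbol q ξ‖ * ‖ξ‖ ^ (2 / 3 : ℝ) = Real.pi⁻¹ * (‖ξ‖ ^ (-(1 / 3) : ℝ) * ‖q ξ‖) := by
    have : ‖ξ‖ ^ (2 / 3 : ℝ) = ‖ξ‖ ^ (-(1 / 3) : ℝ) * ‖ξ‖ := by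
      rw [← Real.rpow_add_one hξ.ne']; norm_num
    rw [this, symbol, norm_div, norm_mul, norm_mul, Complex.norm_I, Complex.norm_conj,
      Complex.norm_real, Real.norm_of_nonneg Real.pi_pos.le]
    field_simp
  rw [e1, e2]
  exact mul_le_of_le_one_left (by positivity)
    (inv_le_one_of_one_le₀ (by linarith [Real.pi_gt_three]))

theorem ennreal_mul_le_sq_add_sq (x y : ℝ≥0∞) : x * y ≤ x ^ 2 + y ^ 2 := by
  rcases le_total x y with h | h
  · exact le_add_left (by rw [sq]; gcongr)
  · exact le_add_right (by rw [sq]; gcongr)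

theorem aestronglyMeasurable_symbol {q : ℂ → ℂ} (hq : AEStronglyMeasurable q volume) :
    AEStronglyMeasurable (symbol q) volume := by
  unfold symbol
  simp only [div_eq_mul_inv]
  refine hq.mul (Measurable.aestronglyMeasurable ?_)
  have : Measurable (starRingEnd ℂ) := Complex.continuous_conj.measurable
  fun_prop

/-- Square integrability of `(1 + |ξ|) q` makes `|ξ|^{2/3}` times the symbol integrable. -/
theorem lintegral_symbol_le {q : ℂ → ℂ} (hq : AEStronglyMeasurable q volume) :
    ∫⁻ ξ, ‖‖symbol q ξ‖ * ‖ξ‖ ^ (2 / 3 : ℝ)‖ₑ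
      ≤ 2 * (∫⁻ ξ, ‖weight ξ‖ₑ ^ 2) + (∫⁻ ξ, ‖q ξ‖ₑ ^ 2) + ∫⁻ ξ, (‖ξ‖ₑ * ‖q ξ‖ₑ) ^ 2 := by
  have hw : AEMeasurable (fun ξ => ‖weight ξ‖ₑ ^ 2) volume :=
    measurable_weight.enorm.aemeasurable.pow_const 2
  have hqm : AEMeasurable (fun ξ => ‖q ξ‖ₑ ^ 2) volume := hq.enorm.pow_const 2
  calc _ ≤ ∫⁻ ξ, ((‖weight ξ‖ₑ ^ 2 + ‖q ξ‖ₑ ^ 2) + (‖weight ξ‖ₑ ^ 2 + (‖ξ‖ₑ * ‖q ξ‖ₑ) ^ 2)) := by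
        refine lintegral_mono fun ξ => ?_
        calc ‖‖symbol q ξ‖ * ‖ξ‖ ^ (2 / 3 : ℝ)‖ₑ
            ≤ ‖weight ξ * ‖q ξ‖ + weight ξ * (‖ξ‖ * ‖q ξ‖)‖ₑ := by
              rw [enorm_le_iff_norm_le, Real.norm_of_nonneg (by positivity)]
              exact (norm_symbol_mul_le q ξ).trans (le_abs_self _)
          _ ≤ ‖weight ξ‖ₑ * ‖q ξ‖ₑ + ‖weight ξ‖ₑ * (‖ξ‖ₑ * ‖q ξ‖ₑ) := by
              refine (enorm_add_le _ _).trans_eq ?_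
              simp only [enorm_mul, enorm_norm]
          _ ≤ _ := add_le_add (ennreal_mul_le_sq_add_sq _ _) (ennreal_mul_le_sq_add_sq _ _)
    _ = _ := by
        have h1 := lintegral_add_left' (hw.add hqm)
          fun ξ => ‖weight ξ‖ₑ ^ 2 + (‖ξ‖ₑ * ‖q ξ‖ₑ) ^ 2
        simp only [Pi.add_apply] at h1
        rw [h1, lintegral_add_left' hw, lintegral_add_left' hw]
        ring

/-! ### The potential of a curl-free field -/

/-- The function with Fourier transform `m`, normalised to vanish at the origin. The subtraction
of `1` makes the integral converge when `m` is singular at the origin. -/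
noncomputable def potential (m : ℂ → ℂ) (w : ℂ) : ℂ := ∫ ξ, m ξ * (chr ξ w - 1)

/-- The left side is at most `2` and at most `2π |ξ| |w - w'|`; interpolate. -/
theorem norm_chr_sub_le (ξ w w' : ℂ) :
    ‖chr ξ w - chr ξ w'‖ ≤ 8 * (‖ξ‖ * ‖w - w'‖) ^ (2 / 3 : ℝ) := by
  rcases le_total 1 (‖ξ‖ * ‖w - w'‖) with h | h
  · have h1 : ‖chr ξ w - chr ξ w'‖ ≤ 2 := (norm_sub_le _ _).trans (by simp; norm_num)
    linarith [Real.one_le_rpow h (by norm_num : (0 : ℝ) ≤ 2 / 3)]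
  · have e : chr ξ w - chr ξ w' = chr ξ w' * (chr ξ (w - w') - 1) := by
      rw [mul_sub, ← chr_add_right]; simp
    have h1 : ‖chr ξ w - chr ξ w'‖ ≤ 2 * Real.pi * (‖ξ‖ * ‖w - w'‖) := by
      rw [e, norm_mul, norm_chr, one_mul, chr_eq]
      refine Real.norm_exp_I_mul_ofReal_sub_one_le.trans ?_
      rw [norm_mul, Real.norm_of_nonneg (by positivity : 0 ≤ 2 * Real.pi)]
      gcongr
      exact norm_inner_le_norm _ _
    have h2 : ‖ξ‖ * ‖w - w'‖ ≤ (‖ξ‖ * ‖w - w'‖) ^ (2 / 3 : ℝ) :=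
      Real.self_le_rpow_of_le_one (by positivity) h (by norm_num)
    have h3 : 2 * Real.pi ≤ 8 := by linarith [Real.pi_le_four]
    calc _ ≤ _ := h1
      _ ≤ 8 * (‖ξ‖ * ‖w - w'‖) ^ (2 / 3 : ℝ) := by gcongr

section Potential

variable {m : ℂ → ℂ}

theorem norm_mul_chr_sub_le (ξ w w' : ℂ) : ‖m ξ * (chr ξ w - chr ξ w')‖
    ≤ 8 * ‖w - w'‖ ^ (2 / 3 : ℝ) * (‖m ξ‖ * ‖ξ‖ ^ (2 / 3 : ℝ)) := by
  rw [norm_mul]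
  calc ‖m ξ‖ * ‖chr ξ w - chr ξ w'‖ ≤ ‖m ξ‖ * (8 * (‖ξ‖ * ‖w - w'‖) ^ (2 / 3 : ℝ)) := by
        gcongr; exact norm_chr_sub_le ξ w w'
    _ = _ := by rw [Real.mul_rpow (norm_nonneg _) (norm_nonneg _)]; ring

theorem integrable_mul_chr_sub (hm : AEStronglyMeasurable m volume)
    (hi : Integrable fun ξ => ‖m ξ‖ * ‖ξ‖ ^ (2 / 3 : ℝ)) (w w' : ℂ) :
    Integrable fun ξ => m ξ * (chr ξ w - chr ξ w') := by
  refine (hi.const_mul (8 * ‖w - w'‖ ^ (2 / 3 : ℝ))).mono' ?_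
    (Eventually.of_forall fun ξ => norm_mul_chr_sub_le ξ w w')
  exact hm.mul ((contDiff_chr_left w).continuous.sub
    (contDiff_chr_left w').continuous).aestronglyMeasurable

/-- The potential of `m` is Hölder continuous because `|ξ|^{2/3} m` is integrable. -/
theorem holderWith_potential {K : ℝ≥0} (hm : AEStronglyMeasurable m volume)
    (hi : Integrable fun ξ => ‖m ξ‖ * ‖ξ‖ ^ (2 / 3 : ℝ))
    (hK : ∫ ξ, ‖m ξ‖ * ‖ξ‖ ^ (2 / 3 : ℝ) ≤ K) :
    HolderWith (8 * K) (2 / 3) (potential m) := by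
  intro w w'
  have h1 : potential m w - potential m w' = ∫ ξ, m ξ * (chr ξ w - chr ξ w') := by
    have hc := fun w => integrable_mul_chr_sub hm hi w 0
    simp only [chr_zero_right] at hc
    rw [potential, potential, ← integral_sub (hc w) (hc w')]
    congr 1 with ξ
    ring
  have h2 : ‖potential m w - potential m w'‖ ≤ 8 * K * ‖w - w'‖ ^ (2 / 3 : ℝ) := by
    rw [h1]
    calc _ ≤ ∫ ξ, 8 * ‖w - w'‖ ^ (2 / 3 : ℝ) * (‖m ξ‖ * ‖ξ‖ ^ (2 / 3 : ℝ)) :=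
          norm_integral_le_of_norm_le (hi.const_mul _)
            (Eventually.of_forall fun ξ => norm_mul_chr_sub_le ξ w w')
      _ ≤ 8 * ‖w - w'‖ ^ (2 / 3 : ℝ) * K := by
          rw [integral_const_mul]; gcongr
      _ = _ := by ring
  have e : ((2 / 3 : ℝ≥0) : ℝ) = 2 / 3 := by norm_num
  rw [edist_dist, edist_dist, e, ENNReal.ofReal_rpow_of_nonneg dist_nonneg (by norm_num),
    ← ENNReal.ofReal_coe_nnreal, ← ENNReal.ofReal_mul (by positivity), dist_eq_norm, dist_eq_norm]
  exact ENNReal.ofReal_le_ofReal (by simpa using h2)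

theorem fourierInv_lineDeriv_apply (v ξ : ℂ) (ψ : 𝓢(ℂ, ℂ)) :
    (𝓕⁻ (∂_{v} ψ) : 𝓢(ℂ, ℂ)) ξ
      = -(2 * Real.pi * Complex.I * (⟪ξ, v⟫ : ℝ) * (𝓕⁻ ψ : 𝓢(ℂ, ℂ)) ξ) := by
  rw [SchwartzMap.fourierInv_lineDerivOp_eq]
  simp only [smul_apply, smul_eq_mul,
    SchwartzMap.smulLeftCLM_apply_apply (hasTemperateGrowth_inner v), Complex.real_smul]
  ring

/-- The inner integral in the pairing of the potential with a derivative. -/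
theorem integral_chr_sub_one_mul_lineDeriv (v ξ : ℂ) (ψ : 𝓢(ℂ, ℂ)) :
    ∫ w, (chr ξ w - 1) * (∂_{v} ψ : 𝓢(ℂ, ℂ)) w
      = -(2 * Real.pi * Complex.I * (⟪ξ, v⟫ : ℝ) * (𝓕⁻ ψ : 𝓢(ℂ, ℂ)) ξ) := by
  have hi : ∀ ξ, Integrable fun w => chr ξ w * (∂_{v} ψ : 𝓢(ℂ, ℂ)) w := fun ξ => by
    refine ((∂_{v} ψ : 𝓢(ℂ, ℂ)).integrable (μ := volume)).norm.mono' ?_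
      (Eventually.of_forall fun w => by simp)
    exact ((continuous_chr.comp (Continuous.prodMk_right ξ)).mul
      (∂_{v} ψ : 𝓢(ℂ, ℂ)).continuous).aestronglyMeasurable
  have h0 : ∫ w, (∂_{v} ψ : 𝓢(ℂ, ℂ)) w = 0 := by
    have h1 := fourierInv_eq_integral_chr (∂_{v} ψ) 0
    rw [fourierInv_lineDeriv_apply] at h1
    simpa [chr] using h1.symm
  simp only [sub_mul, one_mul]
  rw [integral_sub (hi ξ) (∂_{v} ψ : 𝓢(ℂ, ℂ)).integrable, h0, sub_zero,
    ← fourierInv_eq_integral_chr, fourierInv_lineDeriv_apply]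

/-- If `2πi ⟨ξ, v⟩ m` is the Fourier transform of `f ∈ L²`, then `f` is the weak derivative of the
potential of `m` in the direction `v`, by Fubini and Parseval. -/
theorem isWeakDeriv_potential {f : L2} {v : ℂ} (hm : AEStronglyMeasurable m volume)
    (hi : Integrable fun ξ => ‖m ξ‖ * ‖ξ‖ ^ (2 / 3 : ℝ))
    (hf : ∀ᵐ ξ, 2 * Real.pi * Complex.I * (⟪ξ, v⟫ : ℝ) * m ξ = (𝓕 f : L2) ξ) :
    IsWeakDeriv v (potential m) f := by
  have hcont : Continuous (potential m) :=
    (holderWith_potential (K := (∫ ξ, ‖m ξ‖ * ‖ξ‖ ^ (2 / 3 : ℝ)).toNNReal) hm hi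
      (Real.le_coe_toNNReal _)).continuous (by norm_num)
  refine ⟨hcont.locallyIntegrable, (Lp.memLp f).locallyIntegrable (by norm_num), fun φ hφ => ?_⟩
  let ψ : 𝓢(ℂ, ℂ) := hφ.2.toSchwartzMap hφ.1
  have hψ : ∀ z, fderiv ℝ φ z v = (∂_{v} ψ : 𝓢(ℂ, ℂ)) z := fun z => by
    rw [SchwartzMap.lineDerivOp_apply_eq_fderiv]; rfl
  have hint : Integrable fun w : ℂ => ‖w‖ ^ (2 / 3 : ℝ) * ‖(∂_{v} ψ : 𝓢(ℂ, ℂ)) w‖ := by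
    refine Continuous.integrable_of_hasCompactSupport ?_ ?_
    · exact (continuous_norm.rpow_const fun _ => .inr (by norm_num)).mul
        (∂_{v} ψ : 𝓢(ℂ, ℂ)).continuous.norm
    · refine HasCompactSupport.mul_left (HasCompactSupport.norm ?_)
      simpa only [hψ] using (hφ.fderiv_apply v).2
  have hprod : Integrable (Function.uncurry fun w ξ : ℂ =>
      m ξ * (chr ξ w - 1) * (∂_{v} ψ : 𝓢(ℂ, ℂ)) w) (volume.prod volume) := by
    refine ((hint.mul_prod hi).const_mul 8).mono' ?_ (Eventually.of_forall fun p => ?_)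
    · refine (hm.comp_snd.mul ?_).mul ?_
      · exact ((continuous_chr.comp continuous_swap).sub continuous_const).aestronglyMeasurable
      · exact ((∂_{v} ψ : 𝓢(ℂ, ℂ)).continuous.comp continuous_fst).aestronglyMeasurable
    · have h1 := norm_mul_chr_sub_le (m := m) p.2 p.1 0
      rw [chr_zero_right, sub_zero] at h1
      change ‖m p.2 * (chr p.2 p.1 - 1) * (∂_{v} ψ : 𝓢(ℂ, ℂ)) p.1‖ ≤ _
      rw [norm_mul]
      calc _ ≤ 8 * ‖p.1‖ ^ (2 / 3 : ℝ) * (‖m p.2‖ * ‖p.2‖ ^ (2 / 3 : ℝ))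
            * ‖(∂_{v} ψ : 𝓢(ℂ, ℂ)) p.1‖ := by gcongr
        _ = _ := by ring
  calc ∫ w, potential m w * fderiv ℝ φ w v
      = ∫ w, ∫ ξ, m ξ * (chr ξ w - 1) * (∂_{v} ψ : 𝓢(ℂ, ℂ)) w := by
        congr 1 with w
        rw [hψ, integral_mul_const, potential]
    _ = ∫ ξ, ∫ w, m ξ * (chr ξ w - 1) * (∂_{v} ψ : 𝓢(ℂ, ℂ)) w := integral_integral_swap hprod
    _ = ∫ ξ, -((𝓕 f : L2) ξ * (𝓕⁻ ψ : 𝓢(ℂ, ℂ)) ξ) := by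
        refine integral_congr_ae ?_
        filter_upwards [hf] with ξ hξ
        simp only [mul_assoc (m ξ)]
        rw [integral_const_mul, integral_chr_sub_one_mul_lineDeriv, ← hξ]
        ring
    _ = -∫ z, f z * φ z := by
        rw [integral_neg, ← integral_mul_fourier, FourierTransform.fourier_fourierInv_eq]
        rfl

end Potential

/-! ### Functions with vanishing weak gradient -/

/-- A locally integrable function with vanishing weak gradient is constant: its mollifications
have vanishing gradient. -/
theorem ae_eq_const_of_isWeakDeriv_zero {g : ℂ → ℂ} (hx : IsWeakDeriv 1 g 0)
    (hy : IsWeakDeriv Complex.I g 0) : ∃ c, g =ᵐ[volume] fun _ => c := by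
  let φ : ℕ → ContDiffBump (0 : ℂ) := fun n =>
    ⟨(n + 1 : ℝ)⁻¹, 2 * (n + 1 : ℝ)⁻¹, by positivity, by
      have : (0 : ℝ) < (n + 1 : ℝ)⁻¹ := by positivity
      linarith⟩
  let L := ContinuousLinearMap.lsmul ℝ ℝ (E := ℂ)
  have hd : ∀ (n : ℕ) (x : ℂ), fderiv ℝ (convolution ((φ n).normed volume) g L volume) x = 0 := by
    intro n x
    have hc : HasCompactSupport ((φ n).normed volume) := (φ n).hasCompactSupport_normed
    have hs : ContDiff ℝ ∞ ((φ n).normed volume) := (φ n).contDiff_normed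
    have h1 := hc.hasFDerivAt_convolution_left L (hs.of_le (by simp)) hx.1 x
    have hcd : Continuous (fderiv ℝ ((φ n).normed volume)) := hs.continuous_fderiv (by simp)
    have hex : ConvolutionExistsAt (fderiv ℝ ((φ n).normed volume)) g x (L.precompL ℂ) volume :=
      (hc.fderiv ℝ).convolutionExists_left (L.precompL ℂ) hcd hx.1 x
    have hdir : ∀ v, IsWeakDeriv v g 0 →
        (convolution (fderiv ℝ ((φ n).normed volume)) g (L.precompL ℂ) volume) x v = 0 := by
      intro v hv
      have ht : IsTestFunction fun t => (((φ n).normed volume (x - t) : ℝ) : ℂ) := by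
        constructor
        · exact Complex.ofRealCLM.contDiff.comp (hs.comp (contDiff_const.sub contDiff_id))
        · exact (hc.comp_homeomorph (Homeomorph.subLeft x)).comp_left (g := Complex.ofReal) rfl
      have h2 := hv.2.2 _ ht
      rw [convolution_eq_swap, ContinuousLinearMap.integral_apply hex.integrable_swap]
      have h3 : ∀ t, fderiv ℝ (fun t => (((φ n).normed volume (x - t) : ℝ) : ℂ)) t v
          = -(fderiv ℝ ((φ n).normed volume) (x - t) v : ℝ) := fun t => by
        have hdt : HasFDerivAt (fun t => (φ n).normed volume (x - t))
            ((fderiv ℝ ((φ n).normed volume) (x - t)).comp (-ContinuousLinearMap.id ℝ ℂ)) t :=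
          ((hs.differentiable (by simp) (x - t)).hasFDerivAt).comp t
            ((hasFDerivAt_id t).const_sub x)
        have := (Complex.ofRealCLM.hasFDerivAt.comp t hdt).fderiv
        have e : (fun t => (((φ n).normed volume (x - t) : ℝ) : ℂ))
          = Complex.ofRealCLM ∘ fun t => (φ n).normed volume (x - t) := rfl
        rw [e, this]
        simp
      simp only [h3, Pi.zero_apply, zero_mul, integral_zero, neg_zero, mul_neg,
        integral_neg, neg_eq_zero] at h2
      refine Eq.trans ?_ h2
      congr 1 with t
      change (fderiv ℝ ((φ n).normed volume) (x - t) v) • g t = _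
      rw [Complex.real_smul, mul_comm]
    rw [h1.fderiv]
    ext v
    have hv : v = v.re • (1 : ℂ) + v.im • Complex.I := by simp [Complex.re_add_im]
    rw [hv, map_add, map_smul, map_smul, hdir 1 hx, hdir Complex.I hy]
    simp
  have hdiff : ∀ n : ℕ, Differentiable ℝ (convolution ((φ n).normed volume) g L volume) :=
    fun n x => ((φ n).hasCompactSupport_normed.hasFDerivAt_convolution_left L
      ((φ n).contDiff_normed.of_le le_rfl) hx.1 x).differentiableAt
  have hlim : ∀ᵐ x, Tendsto (fun n => convolution ((φ n).normed volume) g L volume x) atTop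
      (𝓝 (g x)) := by
    refine ContDiffBump.ae_convolution_tendsto_right_of_locallyIntegrable (K := 2) ?_
      (Eventually.of_forall fun n => le_rfl) hx.1
    simpa [one_div] using (tendsto_one_div_add_atTop_nhds_zero_nat (𝕜 := ℝ)).const_mul 2
  obtain ⟨x₀, hx₀⟩ := hlim.exists
  refine ⟨g x₀, ?_⟩
  filter_upwards [hlim] with x h
  refine tendsto_nhds_unique h (hx₀.congr fun n => ?_)
  exact is_const_of_fderiv_eq_zero (hdiff n) (hd n) x₀ x

/-! ### Hölder regularity -/

theorem IsTestFunction.integrable_mul {g φ : ℂ → ℂ} (hφ : IsTestFunction φ)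
    (hg : LocallyIntegrable g volume) : Integrable fun z => g z * φ z := by
  simpa only [smul_eq_mul, mul_comm] using
    hg.integrable_smul_left_of_hasCompactSupport hφ.1.continuous hφ.2

theorem integral_mul_combination {g gx gy φ : ℂ → ℂ} (hx : IsWeakDeriv 1 g gx)
    (hy : IsWeakDeriv Complex.I g gy) (hφ : IsTestFunction φ) (c : ℂ) :
    ∫ z, g z * ((fderiv ℝ φ z 1 + c * fderiv ℝ φ z Complex.I) / 2)
      = -∫ z, (gx z + c * gy z) / 2 * φ z := by
  have e1 : ∀ z, g z * ((fderiv ℝ φ z 1 + c * fderiv ℝ φ z Complex.I) / 2)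
      = 2⁻¹ * (g z * fderiv ℝ φ z 1) + (2⁻¹ * c) * (g z * fderiv ℝ φ z Complex.I) :=
    fun z => by ring
  have e2 : ∀ z, (gx z + c * gy z) / 2 * φ z
      = 2⁻¹ * (gx z * φ z) + (2⁻¹ * c) * (gy z * φ z) := fun z => by ring
  simp only [e1, e2]
  rw [integral_add (((hφ.fderiv_apply 1).integrable_mul hx.1).const_mul _)
      (((hφ.fderiv_apply Complex.I).integrable_mul hx.1).const_mul _),
    integral_add ((hφ.integrable_mul hx.2.1).const_mul _) ((hφ.integrable_mul hy.2.1).const_mul _)]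
  simp only [integral_const_mul]
  rw [hx.2.2 φ hφ, hy.2.2 φ hφ]
  ring

/-- A distributional solution with locally integrable weak gradient solves the equation almost
everywhere. -/
theorem SolvesInDistribution.ae_eq {μ F g gx gy : ℂ → ℂ} (hs : SolvesInDistribution μ F g)
    (hμ : ContDiff ℝ ∞ μ) (hF : Continuous F) (hx : IsWeakDeriv 1 g gx)
    (hy : IsWeakDeriv Complex.I g gy) :
    ∀ᵐ z, (gx z + Complex.I * gy z) / 2 - μ z * ((gx z - Complex.I * gy z) / 2) = F z := by
  have hl : ∀ c : ℂ, LocallyIntegrable (fun z => (gx z + c * gy z) / 2) volume := fun c => by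
    simp only [div_eq_inv_mul]
    exact (hx.2.1.add (hy.2.1.smul c)).smul (2⁻¹ : ℂ)
  have hlm : LocallyIntegrable (fun z => μ z * ((gx z + -Complex.I * gy z) / 2)) volume :=
    (hl _).continuous_mul hμ.continuous
  have hmain := ae_eq_of_integral_schwartz_mul_eq ((hl Complex.I).sub hlm) hF.locallyIntegrable
    fun ψ hψ => by
      have hφ : IsTestFunction ψ := ⟨ψ.smooth ⊤, hψ⟩
      have hμφ : IsTestFunction fun w => μ w * ψ w := ⟨hμ.mul (ψ.smooth ⊤), hψ.mul_left⟩
      rw [← hs ψ hφ]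
      have h1 := integral_mul_combination hx hy hφ Complex.I
      have h2 := integral_mul_combination hx hy hμφ (-Complex.I)
      have i1 := (hφ.fderiv_apply 1).integrable_mul hx.1
      have i2 := (hφ.fderiv_apply Complex.I).integrable_mul hx.1
      have j1 := (hμφ.fderiv_apply 1).integrable_mul hx.1
      have j2 := (hμφ.fderiv_apply Complex.I).integrable_mul hx.1
      have k1 : Integrable fun z => g z * dzbar ψ z := by
        refine ((i1.const_mul 2⁻¹).add (i2.const_mul (2⁻¹ * Complex.I))).congr
          (Eventually.of_forall fun z => ?_)
        simp only [dzbar, Pi.add_apply]; ring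
      have k2 : Integrable fun z => g z * dz (fun w => μ w * ψ w) z := by
        refine ((j1.const_mul 2⁻¹).sub (j2.const_mul (2⁻¹ * Complex.I))).congr
          (Eventually.of_forall fun z => ?_)
        simp only [dz, Pi.sub_apply]; ring
      simp only [mul_sub]
      rw [integral_sub k1 k2]
      simp only [dz, dzbar, neg_mul, ← sub_eq_add_neg] at h1 h2 ⊢
      rw [h1, h2]
      simp only [Pi.sub_apply, sub_mul]
      have l1 := hφ.integrable_mul (hl Complex.I)
      have l2 := hφ.integrable_mul hlm
      simp only [neg_mul, ← sub_eq_add_neg] at l2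
      rw [integral_sub l1 l2]
      have : ∀ z, (gx z - Complex.I * gy z) / 2 * (μ z * ψ z)
        = μ z * ((gx z - Complex.I * gy z) / 2) * ψ z := fun z => by ring
      simp only [this]
      ring
  filter_upwards [hmain] with z hz
  rw [← hz]
  simp [sub_eq_add_neg]

/-- The Fourier transforms of `∂_x g` and `∂_y g` in terms of that of `∂_z g`. -/
theorem mul_symbol_eq {a b : ℂ} {ξ : ℂ} {q : ℂ → ℂ} (hξ : ξ ≠ 0)
    (h : (ξ.im : ℂ) * a = ξ.re * b) (hq : q ξ = (a - Complex.I * b) / 2) :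
    2 * Real.pi * Complex.I * (⟪ξ, 1⟫ : ℝ) * symbol q ξ = a ∧
    2 * Real.pi * Complex.I * (⟪ξ, Complex.I⟫ : ℝ) * symbol q ξ = b := by
  have hπ : (Real.pi : ℂ) ≠ 0 := by exact_mod_cast Real.pi_ne_zero
  have hc : (starRingEnd ℂ) ξ ≠ 0 := by simpa using hξ
  have e : (starRingEnd ℂ) ξ = ξ.re - ξ.im * Complex.I := by
    apply Complex.ext <;> simp
  have h1 : (⟪ξ, 1⟫ : ℝ) = ξ.re := by simp
  have h2 : (⟪ξ, Complex.I⟫ : ℝ) = ξ.im := by simp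
  rw [h1, h2, symbol, hq]
  constructor
  · field_simp
    rw [e]
    linear_combination Complex.I * h
  · field_simp
    rw [e]
    linear_combination h

theorem holderWith_add_const {C r : ℝ≥0} {f : ℂ → ℂ} (hf : HolderWith C r f) (c : ℂ) :
    HolderWith C r fun z => f z + c := fun x y => by
  simpa only [edist_add_right] using hf x y

/-- A function whose weak gradient is `(gx, gy) ∈ L²`, with `∂_z g` bounded in `L²` and Lipschitz
under translation in `L²`, is Hölder continuous of exponent `2/3`, with a uniform constant. -/
theorem exists_holderWith {g gx gy Q : ℂ → ℂ} (hx : IsWeakDeriv 1 g gx)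
    (hy : IsWeakDeriv Complex.I g gy) (hgx : MemLp gx 2 volume) (hgy : MemLp gy 2 volume)
    (hQ : Q = fun z => (gx z - Complex.I * gy z) / 2) {N M : ℝ≥0∞} (hN : N ≠ ⊤) (hM : M ≠ ⊤)
    (hQN : eLpNorm Q 2 volume ≤ N)
    (hQM : ∀ w, eLpNorm (fun z => Q (z + w) - Q z) 2 volume ≤ M * ‖w‖ₑ) :
    ∃ h : ℂ → ℂ, HolderWith
      (8 * (2 * (∫⁻ ξ, ‖weight ξ‖ₑ ^ 2) + N ^ 2 + 2 * M ^ 2).toNNReal) (2 / 3) h ∧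
        g =ᵐ[volume] h := by
  let f₁ : L2 := hgx.toLp
  let f₂ : L2 := hgy.toLp
  let q : L2 := (2⁻¹ : ℂ) • (f₁ + (-Complex.I) • f₂)
  have hf₁ : f₁ =ᵐ[volume] gx := hgx.coeFn_toLp
  have hf₂ : f₂ =ᵐ[volume] gy := hgy.coeFn_toLp
  have hq : q =ᵐ[volume] Q := by
    filter_upwards [Lp.coeFn_smul (2⁻¹ : ℂ) (f₁ + (-Complex.I) • f₂),
      Lp.coeFn_add f₁ ((-Complex.I) • f₂), Lp.coeFn_smul (-Complex.I) f₂, hf₁, hf₂]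
      with z h1 h2 h3 h4 h5
    rw [h1, Pi.smul_apply, h2, Pi.add_apply, h3, Pi.smul_apply, h4, h5, hQ]
    simp only [smul_eq_mul]; ring
  have hcurl : IsCurlFree f₁ f₂ := (hx.isCurlFree hy).congr hf₁.symm hf₂.symm
  have hqF : ∀ᵐ ξ, (𝓕 q : L2) ξ = ((𝓕 f₁ : L2) ξ - Complex.I * (𝓕 f₂ : L2) ξ) / 2 := by
    have e : (𝓕 q : L2) = (2⁻¹ : ℂ) • (𝓕 (f₁ + (-Complex.I) • f₂) : L2) :=
      FourierTransform.fourier_smul _ _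
    rw [e]
    filter_upwards [Lp.coeFn_smul (2⁻¹ : ℂ) (𝓕 (f₁ + (-Complex.I) • f₂) : L2),
      fourier_combination f₁ f₂ (-Complex.I)] with ξ h1 h2
    rw [h1, Pi.smul_apply, h2, smul_eq_mul]; ring
  have hsym : ∀ᵐ ξ,
      2 * Real.pi * Complex.I * (⟪ξ, 1⟫ : ℝ) * symbol (𝓕 q : L2) ξ = (𝓕 f₁ : L2) ξ ∧
      2 * Real.pi * Complex.I * (⟪ξ, Complex.I⟫ : ℝ) * symbol (𝓕 q : L2) ξ = (𝓕 f₂ : L2) ξ := by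
    filter_upwards [hcurl.fourier, hqF, Measure.ae_ne volume (0 : ℂ)] with ξ h1 h2 h3
    exact mul_symbol_eq h3 h1 h2
  have hqm : AEStronglyMeasurable (𝓕 q : L2) volume := (Lp.memLp (𝓕 q : L2)).1
  have hm := aestronglyMeasurable_symbol hqm
  set m := symbol (𝓕 q : L2)
  set K := 2 * (∫⁻ ξ, ‖weight ξ‖ₑ ^ 2) + N ^ 2 + 2 * M ^ 2
  have hW : ∫⁻ ξ, ‖weight ξ‖ₑ ^ 2 ≠ ⊤ := by
    have := integrable_weight_sq.2
    simpa only [HasFiniteIntegral, enorm_pow] using this.ne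
  have hK : K ≠ ⊤ := by finiteness
  have hqM : ∀ w, eLpNorm (fun z => q (z + w) - q z) 2 volume ≤ M * ‖w‖ₑ := fun w => by
    refine (eLpNorm_congr_ae ?_).trans_le (hQM w)
    filter_upwards [hq, (measurePreserving_add_right volume w).quasiMeasurePreserving.ae hq]
      with z h1 h2
    rw [h1, h2]
  have hle : ∫⁻ ξ, ‖‖m ξ‖ * ‖ξ‖ ^ (2 / 3 : ℝ)‖ₑ ≤ K := by
    refine (lintegral_symbol_le hqm).trans ?_
    refine add_le_add (add_le_add le_rfl ?_) (lintegral_norm_fourier_le hqM)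
    rw [lintegral_enorm_sq, eLpNorm_fourier, eLpNorm_congr_ae hq]
    exact pow_le_pow_left' hQN 2
  have hi : Integrable fun ξ => ‖m ξ‖ * ‖ξ‖ ^ (2 / 3 : ℝ) := by
    refine ⟨hm.norm.mul (Measurable.aestronglyMeasurable (by fun_prop)), ?_⟩
    exact hle.trans_lt hK.lt_top
  have hiK : ∫ ξ, ‖m ξ‖ * ‖ξ‖ ^ (2 / 3 : ℝ) ≤ K.toNNReal := by
    have e : ∫ ξ, ‖m ξ‖ * ‖ξ‖ ^ (2 / 3 : ℝ) = ∫ ξ, ‖‖m ξ‖ * ‖ξ‖ ^ (2 / 3 : ℝ)‖ := by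
      congr 1 with ξ
      rw [Real.norm_of_nonneg (by positivity)]
    rw [e, integral_norm_eq_lintegral_enorm hi.1]
    exact ENNReal.toReal_mono hK hle
  have hpx : IsWeakDeriv 1 (potential m) f₁ :=
    isWeakDeriv_potential hm hi (hsym.mono fun _ h => h.1)
  have hpy : IsWeakDeriv Complex.I (potential m) f₂ :=
    isWeakDeriv_potential hm hi (hsym.mono fun _ h => h.2)
  have hsub : ∀ {v : ℂ} {g' : ℂ → ℂ} {f : L2}, IsWeakDeriv v g g' →
      IsWeakDeriv v (potential m) f → f =ᵐ[volume] g' →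
      IsWeakDeriv v (fun z => g z - potential m z) 0 := by
    intro v g' f h1 h2 h3
    refine ⟨h1.1.sub h2.1, locallyIntegrable_zero, fun φ hφ => ?_⟩
    have e : ∫ z, f z * φ z = ∫ z, g' z * φ z :=
      integral_congr_ae (by filter_upwards [h3] with z hz; rw [hz])
    simp only [sub_mul]
    rw [integral_sub ((hφ.fderiv_apply v).integrable_mul h1.1)
      ((hφ.fderiv_apply v).integrable_mul h2.1), h1.2.2 φ hφ, h2.2.2 φ hφ, e]
    simp
  obtain ⟨c, hc⟩ := ae_eq_const_of_isWeakDeriv_zero (hsub hx hpx hf₁) (hsub hy hpy hf₂)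
  refine ⟨fun z => potential m z + c, holderWith_add_const (holderWith_potential hm hi hiK) c, ?_⟩
  filter_upwards [hc] with z hz
  rw [← hz]; ring

end Beltrami

theorem mainTheorem3 (k : ℝ) (hk : k < 1) (μ F : ℂ → ℂ)
    (hμ : ContDiff ℝ ∞ μ) (hμc : HasCompactSupport μ) (hμk : ∀ z, ‖μ z‖ ≤ k)
    (hF : ContDiff ℝ ∞ F) (hFc : HasCompactSupport F) :
    -- the Hölder constant depends only on `μ`, `F` and the `L⁶`-norm of `g` on the support of `μ`
    ∃ C : ℝ≥0∞ → ℝ≥0, ∀ g : ℂ → ℂ, LocallyIntegrable g volume → Beltrami.HasL2Gradient g →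
      Beltrami.SolvesInDistribution μ F g →
      ∃ h : ℂ → ℂ, HolderWith (C (eLpNorm g 6 (volume.restrict (tsupport μ)))) (2 / 3) h ∧
        g =ᵐ[volume] h := by
  obtain ⟨Lμ, hLμ⟩ := hμ.lipschitzWith_of_hasCompactSupport hμc (by simp)
  obtain ⟨LF, hLF⟩ := hF.lipschitzWith_of_hasCompactSupport hFc (by simp)
  obtain ⟨N, hN, hFN⟩ := Beltrami.exists_eLpNorm_translate_sub_le hLF hFc
  have hFm : MemLp F 2 volume := hF.continuous.memLp_of_hasCompactSupport hFc
  -- `A` bounds `∂_z g` in `L²`, and `M` bounds the derivatives of `∂_z g` in `L²`; neither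
  -- depends on `g`, so that the Hölder constant is uniform over all solutions.
  let A : ℝ≥0∞ := ENNReal.ofReal (1 - k)⁻¹ * eLpNorm F 2 volume
  let M : ℝ≥0∞ := ENNReal.ofReal (1 - k)⁻¹ * (N + Lμ * A)
  have hA : A ≠ ⊤ := ENNReal.mul_ne_top ENNReal.ofReal_ne_top hFm.2.ne
  have hM : M ≠ ⊤ := by finiteness
  refine ⟨fun _ => 8 * (2 * (∫⁻ ξ, ‖Beltrami.weight ξ‖ₑ ^ 2) + A ^ 2 + 2 * M ^ 2).toNNReal,
    fun g _ ⟨gx, gy, hx, hy, hgx, hgy⟩ hs => ?_⟩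
  have hE := hs.ae_eq hμ hF.continuous hx hy
  have hcurl := hx.isCurlFree hy
  have hQA := hcurl.energy_estimate hk hμk hμ.continuous hgx hgy hE
  refine Beltrami.exists_holderWith hx hy hgx hgy rfl hA hM hQA fun w => ?_
  refine (hcurl.translate_estimate hk hμk hLμ hFm.1 hFN hgx hgy hE rfl w).trans ?_
  gcongr
  exact mul_le_mul_right (add_le_add_right (mul_le_mul_right hQA _) _) _
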